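/- Let $\alpha,\beta$ be real numbers, neither of which is a negative integer, with $\alpha+\beta>-1$. Let $\mathbb D=\{z\in\mathbb C:|z|<1\}$ and let $$L_{\alpha,\beta}=(1-|z|^2)\Big((1-|z|^2)\frac{\partial^2}{\partial z\,\partial\overline z}+\alpha z\frac{\partial}{\partial z}+\beta\overline z\frac{\partial}{\partial\overline z}-\alpha\beta\Big).$$ A function $u:\mathbb D\to\mathbb C$ is called $(\alpha,\beta)$-harmonic if it is of class $C^2$ and $L_{\alpha,\beta}u=0$ on $\mathbb D$, and sense-preserving if $|u_z|>|u_{\overline z}|$ everywhere on $\mathbb D$. Let $\mathcal S_{(\alpha,\beta)}$ be the class of all univalent (that is, injective) sense-preserving $(\alpha,\beta)$-harmonic functions $u$ on $\mathbb D$ with a convergent expansion $$u(z)=\sum_{k=0}^{\infty}c_kF(-\alpha,k-\beta;k+1;|z|^2)\,z^k+\sum_{k=1}^{\infty}c_{-k}F(-\beta,k-\alpha;k+1;|z|^2)\,\overline z^{\,k}\qquad(z\in\mathbb D),\tag{1}$$ where $F$ is the Gauss hypergeometric function, $c_k\in\mathbb C$ and $\limsup_{|k|\to\infty}|c_k|^{1/|k|}\le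 1$, that is normalized by $c_0=0$ and $c_1=1$. Let $T\mathcal S_{(\alpha,\beta)}$ be the subclass of those $u\in\mathcal S_{(\alpha,\beta)}$ whose coefficients $c_k$ in (1) are real (the typically real $(\alpha,\beta)$-harmonic functions). Let $u\in T\mathcal S_{(\alpha,\beta)}$ have the expansion (1) with coefficients $c_k$. Then, for every integer $k\ge 2$, $$\left|\frac{\Gamma(1+\alpha)\,c_k}{\Gamma(k+1+\alpha)}-\frac{\Gamma(1+\beta)\,c_{-k}}{\Gamma(k+1+\beta)}\right|\le\frac{1}{\Gamma(k)}\left|\frac{1}{1+\alpha}-\frac{c_{-1}}{1+\beta}\right|.$$ -/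

import Mathlib

namespace AlphaBetaHarmonic

/-- The open unit disk. -/
def unitDisk : Set ℂ := Metric.ball (0 : ℂ) 1

/-- The Wirtinger derivative `∂/∂z = (∂/∂x - i ∂/∂y) / 2`. -/
noncomputable def dz (u : ℂ → ℂ) (z : ℂ) : ℂ :=
  (1 / 2 : ℂ) * (fderiv ℝ u z 1 - Complex.I * fderiv ℝ u z Complex.I)

/-- The Wirtinger derivative `∂/∂z̄ = (∂/∂x + i ∂/∂y) / 2`. -/
noncomputable def dzbar (u : ℂ → ℂ) (z : ℂ) : ℂ :=
  (1 / 2 : ℂ) * (fderiv ℝ u z 1 + Complex.I * fderiv ℝ u z Complex.I)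

/-- The second order operator
`L_{α,β} = (1-|z|²) ((1-|z|²) ∂²/∂z∂z̄ + α z ∂/∂z + β z̄ ∂/∂z̄ - αβ)`. -/
noncomputable def opL (α β : ℝ) (u : ℂ → ℂ) (z : ℂ) : ℂ :=
  (1 - (‖z‖ : ℂ) ^ 2) *
    ((1 - (‖z‖ : ℂ) ^ 2) * dz (dzbar u) z + (α : ℂ) * z * dz u z
      + (β : ℂ) * (starRingEnd ℂ z) * dzbar u z - (α : ℂ) * (β : ℂ) * u z)

/-- `u` is `(α,β)`-harmonic on the unit disk: it is `C²` there and `L_{α,β} u = 0`. -/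
def IsHarmonic (α β : ℝ) (u : ℂ → ℂ) : Prop :=
  ContDiffOn ℝ 2 u unitDisk ∧ ∀ z ∈ unitDisk, opL α β u z = 0

/-- `u` is sense-preserving on the unit disk: `|u_z| > |u_z̄|` everywhere. -/
def SensePreserving (u : ℂ → ℂ) : Prop :=
  ∀ z ∈ unitDisk, ‖dzbar u z‖ < ‖dz u z‖

/-- The `k`-th term `c_k F(-α, k-β; k+1; |z|²) z^k` of the first series. -/
noncomputable def posTerm (α β : ℝ) (c : ℤ → ℂ) (z : ℂ) (k : ℕ) : ℂ :=
  c k * ((ordinaryHypergeometric (-α) ((k : ℝ) - β) ((k : ℝ) + 1) (‖z‖ ^ 2) : ℝ) : ℂ) * z ^ k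

/-- The `k`-th term `c_{-k} F(-β, k-α; k+1; |z|²) z̄^k` of the second series. -/
noncomputable def negTerm (α β : ℝ) (c : ℤ → ℂ) (z : ℂ) (k : ℕ) : ℂ :=
  c (-(k : ℤ)) *
    ((ordinaryHypergeometric (-β) ((k : ℝ) - α) ((k : ℝ) + 1) (‖z‖ ^ 2) : ℝ) : ℂ) *
      (starRingEnd ℂ z) ^ k

/-- `c` is the coefficient sequence of `u`: `limsup_{|k| → ∞} |c_k|^{1/|k|} ≤ 1` and, on the unit
disk, `u z = ∑_{k ≥ 0} c_k F(-α,k-β;k+1;|z|²) z^k + ∑_{k ≥ 1} c_{-k} F(-β,k-α;k+1;|z|²) z̄^k`,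
both series being convergent. -/
def HasExpansion (α β : ℝ) (u : ℂ → ℂ) (c : ℤ → ℂ) : Prop :=
  Filter.limsup (fun k : ℤ => ‖c k‖ₑ ^ (1 / |(k : ℝ)|)) Filter.cofinite ≤ 1 ∧
  ∀ z ∈ unitDisk,
    Summable (fun k : ℕ => posTerm α β c z k) ∧
    Summable (fun k : ℕ => negTerm α β c z (k + 1)) ∧
    u z = ∑' k : ℕ, posTerm α β c z k + ∑' k : ℕ, negTerm α β c z (k + 1)

/-- The class `S_{(α,β)}` of univalent sense-preserving `(α,β)`-harmonic functions on the unit disk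
normalized by `c_0 = 0` and `c_1 = 1`. -/
def classS (α β : ℝ) : Set (ℂ → ℂ) :=
  {u | IsHarmonic α β u ∧ Set.InjOn u unitDisk ∧ SensePreserving u ∧
    ∃ c : ℤ → ℂ, HasExpansion α β u c ∧ c 0 = 0 ∧ c 1 = 1}

/-- The class `TS_{(α,β)}` of typically real `(α,β)`-harmonic functions: the members of
`S_{(α,β)}` with real coefficients. -/
def classTS (α β : ℝ) : Set (ℂ → ℂ) :=
  {u | u ∈ classS α β ∧ ∃ c : ℤ → ℝ, HasExpansion α β u (fun k => (c k : ℂ))}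

end AlphaBetaHarmonic

/-! Real coefficients give `u (conj z) = conj (u z)`, so a real value of `u` at a non-real point
would contradict injectivity. Hence `Im u` has constant sign on the upper half disk, and `Im u * Im
z` has constant sign on the disk (`im_mul_im_sign`).

On the circle of radius `r < 1` the expansion is an absolutely convergent Fourier series, and `∫ Im
u * sin kθ` is `π` times the difference of its `k`-th and `-k`-th coefficients. Since `|sin kθ| ≤ k
|sin θ|` and `Im u * sin θ` keeps its sign, this difference is at most `k` times the one for `k =
1`, in absolute value (`norm_posTerm_sub_negTerm_le`).

As `r → 1`, Abel's theorem replaces the hypergeometric factors by their values at `1`. A contiguity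
relation evaluates these as `k! G Γ(1+α)/Γ(k+1+α)` and the same with `β`, where `G = F(-α,-β;1;1)`
is symmetric in `α, β` and nonzero. Dividing by `k |G| (k-1)!` gives the bound. -/

open Filter Topology

/-! ### Hypergeometric series at the point 1 -/

/-- A form of Raabe's test, with the accompanying decay of the terms. -/
theorem summable_and_tendsto_of_raabe {t : ℕ → ℝ} {δ : ℝ} (hδ : 0 < δ)
    (h : ∀ᶠ n : ℕ in atTop, δ * |t n| ≤ n * |t n| - (n + 1) * |t (n + 1)|) :
    Summable t ∧ Tendsto (fun n : ℕ => n * t n) atTop (𝓝 0) := by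
  obtain ⟨N, hN⟩ := eventually_atTop.1 h
  set d : ℕ → ℝ := fun i => ((i + N : ℕ) : ℝ) * |t (i + N)| with hd
  have hd0 : ∀ i, 0 ≤ d i := fun i => by positivity
  have hstep : ∀ i, δ * |t (i + N)| ≤ d i - d (i + 1) := fun i => by
    have := hN (i + N) (by omega)
    have e : i + 1 + N = i + N + 1 := by omega
    simp only [hd, e]
    push_cast at this ⊢
    linarith
  have hsum : Summable fun i => |t (i + N)| := by
    refine summable_of_sum_range_le (c := d 0 / δ) (fun i => abs_nonneg _) fun m => ?_
    rw [le_div_iff₀ hδ, mul_comm, Finset.mul_sum]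
    calc ∑ i ∈ Finset.range m, δ * |t (i + N)|
        ≤ ∑ i ∈ Finset.range m, (d i - d (i + 1)) := Finset.sum_le_sum fun i _ => hstep i
      _ = d 0 - d m := Finset.sum_range_sub' d m
      _ ≤ d 0 := by linarith [hd0 m]
  have hts : Summable fun n => |t n| := (summable_nat_add_iff N).1 hsum
  refine ⟨hts.of_abs, ?_⟩
  have hanti : Antitone d := antitone_nat_of_succ_le fun i => by
    have := hstep i
    have : 0 ≤ δ * |t (i + N)| := by positivity
    linarith
  have hlim : Tendsto d atTop (𝓝 (⨅ i, d i)) :=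
    tendsto_atTop_ciInf hanti ⟨0, by rintro _ ⟨i, rfl⟩; exact hd0 i⟩
  -- A positive limit `L` would give `1/n ≤ |t n| / L`, making the harmonic series converge.
  have hL : (⨅ i, d i) = 0 := by
    by_contra hne
    have hpos : 0 < ⨅ i, d i := lt_of_le_of_ne (le_ciInf hd0) (Ne.symm hne)
    have hs : Summable fun i : ℕ => (1 : ℝ) / ((i + N : ℕ) : ℝ) := by
      refine Summable.of_nonneg_of_le (fun i => by positivity) (fun i => ?_)
        (hsum.mul_left (⨅ i, d i)⁻¹)
      have hle : (⨅ i, d i) ≤ d i := ciInf_le ⟨0, by rintro _ ⟨i, rfl⟩; exact hd0 i⟩ i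
      rcases Nat.eq_zero_or_pos (i + N) with h0 | h0
      -- The index `0` is harmless because `1 / 0 = 0`.
      · rw [h0]; simp; positivity
      · have h0' : (0 : ℝ) < ((i + N : ℕ) : ℝ) := by exact_mod_cast h0
        rw [div_le_iff₀ h0', mul_assoc, ← div_eq_inv_mul, le_div_iff₀ hpos, one_mul, mul_comm]
        exact hle
    exact Real.not_summable_one_div_natCast
      ((summable_nat_add_iff (f := fun n : ℕ => (1 : ℝ) / (n : ℝ)) N).1 hs)
  rw [hL] at hlim
  have h2 : Tendsto (fun n : ℕ => (n : ℝ) * |t n|) atTop (𝓝 0) :=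
    (tendsto_add_atTop_iff_nat N).1 hlim
  refine squeeze_zero_norm (fun n => ?_) h2
  rw [Real.norm_eq_abs, abs_mul, Nat.abs_cast]

/-- The ratio of consecutive hypergeometric coefficients. -/
theorem hypergeometricCoefficient_succ {a b c : ℝ} (hc : 0 < c) (n : ℕ) :
    (n + 1) * ordinaryHypergeometricCoefficient a b c (n + 1) =
      ordinaryHypergeometricCoefficient a b c n * ((a + n) * (b + n) / (c + n)) := by
  have h1 := (ascPochhammer_pos n c hc).ne'
  have h2 : c + n ≠ 0 := by positivity
  have h3 : ((n : ℝ) + 1) ≠ 0 := by positivity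
  have h4 : (n.factorial : ℝ) ≠ 0 := by positivity
  simp only [ordinaryHypergeometricCoefficient, ascPochhammer_succ_eval, Nat.factorial_succ]
  push_cast
  field_simp

/-- The Raabe quantity `n - (a+n)(b+n)/(c+n)` tends to `c - a - b`, so half of that is an eventual
lower bound. The decay of `n * t n` later removes a boundary term. -/
theorem hypergeometricCoefficient_summable {a b c : ℝ} (hc : 0 < c) (hs : 0 < c - a - b) :
    Summable (ordinaryHypergeometricCoefficient a b c) ∧
      Tendsto (fun n : ℕ => n * ordinaryHypergeometricCoefficient a b c n) atTop (𝓝 0) := by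
  refine summable_and_tendsto_of_raabe (δ := (c - a - b) / 2) (by positivity) ?_
  have hcast := tendsto_natCast_atTop_atTop (R := ℝ)
  filter_upwards [hcast.eventually_ge_atTop (-a), hcast.eventually_ge_atTop (-b),
    hcast.eventually_ge_atTop ((a * b + (c - a - b) / 2 * c) / ((c - a - b) / 2))] with n h1 h2 h3
  rw [div_le_iff₀ (by positivity)] at h3
  have hcn : 0 < c + n := by positivity
  have e : ((n : ℝ) + 1) * |ordinaryHypergeometricCoefficient a b c (n + 1)| =
      |ordinaryHypergeometricCoefficient a b c n| * ((a + n) * (b + n) / (c + n)) := by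
    rw [← abs_of_nonneg (show (0 : ℝ) ≤ (n : ℝ) + 1 by positivity), ← abs_mul,
      hypergeometricCoefficient_succ hc, abs_mul]
    congr 1
    exact abs_of_nonneg (div_nonneg (mul_nonneg (by linarith) (by linarith)) hcn.le)
  rw [e]
  have key : (c - a - b) / 2 ≤ n - (a + n) * (b + n) / (c + n) := by
    rw [le_sub_iff_add_le, ← le_sub_iff_add_le', div_le_iff₀ hcn]
    nlinarith
  nlinarith [mul_le_mul_of_nonneg_right key (abs_nonneg (ordinaryHypergeometricCoefficient a b c n))]

/-- The value at `1` of the hypergeometric series with parameters `a`, `b`, `c`. -/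
noncomputable def hypergeometricSum (a b c : ℝ) : ℝ :=
  ∑' n, ordinaryHypergeometricCoefficient a b c n

theorem hypergeometricSum_comm (a b c : ℝ) : hypergeometricSum a b c = hypergeometricSum b a c :=
  tsum_congr fun n => by simp only [ordinaryHypergeometricCoefficient]; ring

theorem ordinaryHypergeometric_tendsto {a b c : ℝ} (hc : 0 < c) (hs : 0 < c - a - b) :
    Tendsto (fun x : ℝ => ordinaryHypergeometric a b c x) (𝓝[<] 1)
      (𝓝 (hypergeometricSum a b c)) := by
  rw [ordinaryHypergeometric_eq_tsum]
  exact Real.tendsto_tsum_powerSeries_nhdsWithin_lt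
    (hypergeometricCoefficient_summable hc hs).1.hasSum.tendsto_sum_nat

/-- Finite telescoping form of `c F(a,b;c;1) = (c-a) F(a,b+1;c+1;1)`; the right side is the boundary
term that vanishes in the limit. -/
theorem sum_range_contiguous {a b c : ℝ} (hc : 0 < c) (n : ℕ) :
    ∑ i ∈ Finset.range (n + 1), (c * ordinaryHypergeometricCoefficient a b c i -
        (c - a) * ordinaryHypergeometricCoefficient a (b + 1) (c + 1) i) =
      (a + n) * ordinaryHypergeometricCoefficient a (b + 1) (c + 1) n := by
  induction n with
  | zero => simp [ordinaryHypergeometricCoefficient]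
  | succ n ih =>
    rw [Finset.sum_range_succ, ih]
    have hleft : ∀ x : ℝ, (ascPochhammer ℝ (n + 1)).eval x =
        x * (ascPochhammer ℝ n).eval (x + 1) := fun x => by
      rw [ascPochhammer_succ_left]; simp
    have h0 : c * ordinaryHypergeometricCoefficient a b c (n + 1) =
        (a + n) * b / (n + 1) * ordinaryHypergeometricCoefficient a (b + 1) (c + 1) n := by
      have h1 := (ascPochhammer_pos n (c + 1) (by positivity)).ne'
      have h3 : ((n : ℝ) + 1) ≠ 0 := by positivity
      have h4 : (n.factorial : ℝ) ≠ 0 := by positivity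
      simp only [ordinaryHypergeometricCoefficient]
      rw [ascPochhammer_succ_eval n a, hleft, hleft, Nat.factorial_succ]
      push_cast
      field_simp
    have h5 := hypergeometricCoefficient_succ (a := a) (b := b + 1) (c := c + 1) (by positivity) n
    have h6 : ordinaryHypergeometricCoefficient a (b + 1) (c + 1) (n + 1) =
        ordinaryHypergeometricCoefficient a (b + 1) (c + 1) n *
          ((a + n) * (b + 1 + n) / (c + 1 + n)) / (n + 1) := by
      rw [← h5]; field_simp
    have h7 : c + 1 + n ≠ 0 := by positivity
    have h3 : ((n : ℝ) + 1) ≠ 0 := by positivity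
    rw [h0, h6]
    push_cast
    field_simp
    ring

theorem hypergeometricSum_contiguous {a b c : ℝ} (hc : 0 < c) (hs : 0 < c - a - b) :
    c * hypergeometricSum a b c = (c - a) * hypergeometricSum a (b + 1) (c + 1) := by
  have h1 := hypergeometricCoefficient_summable hc hs
  have h2 := hypergeometricCoefficient_summable (a := a) (b := b + 1) (c := c + 1)
    (by positivity) (by linarith)
  have hA := ((h1.1.hasSum.mul_left c).sub (h2.1.hasSum.mul_left (c - a))).tendsto_sum_nat.comp
    (tendsto_add_atTop_nat 1)
  have hB : Tendsto (fun n : ℕ =>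
      (a + n) * ordinaryHypergeometricCoefficient a (b + 1) (c + 1) n) atTop (𝓝 0) := by
    have := (h2.1.tendsto_atTop_zero.const_mul a).add h2.2
    simp only [mul_zero, add_zero] at this
    exact this.congr fun n => by ring
  have := tendsto_nhds_unique (hA.congr fun n => sum_range_contiguous hc n) hB
  unfold hypergeometricSum
  linarith

theorem hypergeometricSum_pos {a b c : ℝ} (ha : 0 < a) (hb : 0 < b) (hc : 0 < c)
    (hs : 0 < c - a - b) : 0 < hypergeometricSum a b c := by
  have hpos : ∀ n, 0 < ordinaryHypergeometricCoefficient a b c n := fun n => by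
    have h1 := ascPochhammer_pos n a ha
    have h2 := ascPochhammer_pos n b hb
    have h3 := ascPochhammer_pos n c hc
    simp only [ordinaryHypergeometricCoefficient]
    positivity
  exact (hypergeometricCoefficient_summable hc hs).1.tsum_pos (fun n => (hpos n).le) 0 (hpos 0)

/-- Raising the second and third parameters by `k`. -/
theorem hypergeometricSum_shift {a b c : ℝ} (hc : 0 < c) (hs : 0 < c - a - b) (k : ℕ) :
    (ascPochhammer ℝ k).eval c * hypergeometricSum a b c =
      (ascPochhammer ℝ k).eval (c - a) * hypergeometricSum a (b + k) (c + k) := by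
  induction k with
  | zero => simp
  | succ k ih =>
    have := hypergeometricSum_contiguous (a := a) (b := b + k) (c := c + k) (by positivity)
      (by linarith)
    rw [ascPochhammer_succ_eval, ascPochhammer_succ_eval, mul_right_comm, ih]
    push_cast
    rw [← add_assoc, ← add_assoc, mul_right_comm, mul_assoc, this]
    ring

theorem ascPochhammer_eval_one_add_ne_zero {α : ℝ} (hα : ∀ n : ℕ, α ≠ -((n : ℝ) + 1)) (k m : ℕ) :
    (ascPochhammer ℝ k).eval (1 + α + m) ≠ 0 := by
  rw [Ne, ascPochhammer_eval_eq_zero_iff]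
  rintro ⟨n, -, hn⟩
  apply hα (n + m)
  push_cast
  linarith

/-- `F(-α, -β; 1; 1) ≠ 0`. -/
theorem hypergeometricSum_ne_zero {α β : ℝ} (hα : ∀ n : ℕ, α ≠ -((n : ℝ) + 1))
    (hβ : ∀ n : ℕ, β ≠ -((n : ℝ) + 1)) (hαβ : -1 < α + β) :
    hypergeometricSum (-α) (-β) 1 ≠ 0 := by
  -- Raising `-β` by `N`, then `-α` by `N` after swapping parameters, reaches a series with positive
  -- terms, because `c - a - b = 1 + α + β` is unchanged. The factors `(1+α)_N` and `(1+β)_N` do not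
  -- vanish, so a zero would propagate to that series.
  obtain ⟨N, hN⟩ := exists_nat_gt (max α β)
  have hNα : α < N := (le_max_left _ _).trans_lt hN
  have hNβ : β < N := (le_max_right _ _).trans_lt hN
  intro h0
  have h1 := hypergeometricSum_shift (a := -α) (b := -β) (c := 1) one_pos (by linarith) N
  rw [h0, mul_zero, hypergeometricSum_comm] at h1
  have e1 : (1 : ℝ) - -α = 1 + α + (0 : ℕ) := by simp
  rw [e1] at h1
  have h2 := (mul_eq_zero.1 h1.symm).resolve_left (ascPochhammer_eval_one_add_ne_zero hα N 0)
  have h3 := hypergeometricSum_shift (a := -β + N) (b := -α) (c := 1 + N) (by positivity)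
    (by linarith) N
  have e2 : (1 : ℝ) + N - (-β + N) = 1 + β + (0 : ℕ) := by push_cast; ring
  rw [h2, mul_zero, e2] at h3
  have h4 := (mul_eq_zero.1 h3.symm).resolve_left (ascPochhammer_eval_one_add_ne_zero hβ N 0)
  exact (hypergeometricSum_pos (a := -β + N) (b := -α + N) (c := 1 + N + N) (by linarith)
    (by linarith) (by positivity) (by linarith)).ne' h4

theorem Gamma_add_nat {x : ℝ} (hx : ∀ n : ℕ, x + n ≠ 0) (k : ℕ) :
    Real.Gamma (x + k) = (ascPochhammer ℝ k).eval x * Real.Gamma x := by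
  induction k with
  | zero => simp
  | succ k ih =>
    push_cast
    rw [← add_assoc, Real.Gamma_add_one (hx k), ih, ascPochhammer_succ_eval]
    ring

/-- `F(-α, k-β; k+1; 1) = k! F(-α, -β; 1; 1) Γ(1+α) / Γ(k+1+α)`. -/
theorem hypergeometricSum_eq_Gamma {α β : ℝ} (hα : ∀ n : ℕ, α ≠ -((n : ℝ) + 1))
    (hαβ : -1 < α + β) (k : ℕ) :
    hypergeometricSum (-α) (k - β) (k + 1) =
      k.factorial * hypergeometricSum (-α) (-β) 1 *
        (Real.Gamma (1 + α) / Real.Gamma (k + 1 + α)) := by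
  have h := hypergeometricSum_shift (a := -α) (b := -β) (c := 1) one_pos (by linarith) k
  have hx : ∀ n : ℕ, 1 + α + n ≠ 0 := fun n h => hα n (by linarith)
  have hG := Gamma_add_nat hx k
  have hΓ : Real.Gamma (1 + α) ≠ 0 := Real.Gamma_ne_zero fun n h => hx n (by linarith)
  have hP := ascPochhammer_eval_one_add_ne_zero hα k 0
  have e : (k : ℝ) + 1 + α = 1 + α + k := by ring
  rw [ascPochhammer_eval_one, sub_neg_eq_add, neg_add_eq_sub, add_comm (1 : ℝ) k] at h
  rw [e, hG, h]
  simp only [Nat.cast_zero, add_zero] at hP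
  field_simp

/-! ### Fourier coefficients of trigonometric series -/

theorem integral_exp_int_mul (n : ℤ) :
    ∫ θ in -Real.pi..Real.pi, Complex.exp (n * θ * Complex.I) =
      if n = 0 then 2 * (Real.pi : ℂ) else 0 := by
  split_ifs with h
  · subst h
    simp
    ring
  · have hn : (n : ℂ) * Complex.I ≠ 0 := mul_ne_zero (by exact_mod_cast h) Complex.I_ne_zero
    have e : ∀ θ : ℝ, Complex.exp (n * θ * Complex.I) = Complex.exp (n * Complex.I * θ) :=
      fun θ => by congr 1; ring
    simp_rw [e]
    rw [integral_exp_mul_complex hn]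
    have : Complex.exp (n * Complex.I * Real.pi) = Complex.exp (n * Complex.I * (-Real.pi : ℝ)) := by
      rw [Complex.exp_eq_exp_iff_exists_int]
      exact ⟨n, by push_cast; ring⟩
    rw [this, sub_self, zero_div]

/-- Fourier coefficients of an absolutely convergent trigonometric series. -/
theorem integral_mul_exp_of_hasSum {d : ℤ → ℂ} {f : ℝ → ℂ}
    (hf : ∀ θ : ℝ, HasSum (fun n : ℤ => d n * Complex.exp (n * θ * Complex.I)) (f θ)) (k : ℤ) :
    ∫ θ in -Real.pi..Real.pi, f θ * Complex.exp (-k * θ * Complex.I) = 2 * Real.pi * d k := by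
  have hd : Summable fun n => ‖d n‖ := by
    -- At `θ = 0` every exponential is `1`.
    have := (hf 0).summable.norm
    simpa using this
  have hnorm : ∀ (n : ℤ) (θ : ℝ), ‖Complex.exp (n * θ * Complex.I)‖ = 1 := fun n θ => by
    have := Complex.norm_exp_ofReal_mul_I (n * θ)
    simpa using this
  have hexp : ∀ (n : ℤ) (θ : ℝ), d n * Complex.exp (n * θ * Complex.I) *
      Complex.exp (-k * θ * Complex.I) = d n * Complex.exp (((n - k : ℤ) : ℂ) * θ * Complex.I) :=
    fun n θ => by
      rw [mul_assoc, ← Complex.exp_add]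
      congr 2
      push_cast
      ring
  have h := intervalIntegral.hasSum_integral_of_dominated_convergence
    (μ := MeasureTheory.volume) (a := -Real.pi) (b := Real.pi)
    (F := fun n θ => d n * Complex.exp (n * θ * Complex.I) * Complex.exp (-k * θ * Complex.I))
    (f := fun θ => f θ * Complex.exp (-k * θ * Complex.I)) (fun n _ => ‖d n‖)
    (fun n => (by fun_prop : Continuous _).aestronglyMeasurable)
    (fun n => Eventually.of_forall fun θ _ => by
      simp only [hexp, norm_mul, hnorm, mul_one, le_refl])
    (Eventually.of_forall fun θ _ => hd) intervalIntegrable_const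
    (Eventually.of_forall fun θ _ => (hf θ).mul_right _)
  refine h.unique ?_
  have e : (fun n : ℤ => ∫ θ in -Real.pi..Real.pi, d n * Complex.exp (n * θ * Complex.I) *
      Complex.exp (-k * θ * Complex.I)) = fun n => if n = k then 2 * Real.pi * d k else 0 := by
    funext n
    simp only [hexp, intervalIntegral.integral_const_mul, integral_exp_int_mul, sub_eq_zero]
    split_ifs with hnk
    · subst hnk; ring
    · simp
  rw [e]
  exact hasSum_ite_eq k _

/-! ### The expansion on circles and uniqueness of its coefficients -/

namespace AlphaBetaHarmonic

/-- The `n`-th Fourier coefficient of the expansion on the circle of radius `r`. -/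
noncomputable def circleCoeff (α β : ℝ) (c : ℤ → ℂ) (r : ℝ) (n : ℤ) : ℂ :=
  if 0 ≤ n then posTerm α β c r n.natAbs else negTerm α β c r n.natAbs

theorem circleCoeff_natCast (α β : ℝ) (c : ℤ → ℂ) (r : ℝ) (k : ℕ) :
    circleCoeff α β c r k = posTerm α β c r k := by
  simp [circleCoeff]

theorem circleCoeff_neg_succ (α β : ℝ) (c : ℤ → ℂ) (r : ℝ) (k : ℕ) :
    circleCoeff α β c r (-((k : ℤ) + 1)) = negTerm α β c r (k + 1) := by
  have h : ¬ (0 : ℤ) ≤ -((k : ℤ) + 1) := by omega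
  have h2 : (-((k : ℤ) + 1)).natAbs = k + 1 := by omega
  rw [circleCoeff, if_neg h, h2]

theorem norm_mul_exp {r : ℝ} (hr : 0 ≤ r) (θ : ℝ) : ‖(r : ℂ) * Complex.exp (θ * Complex.I)‖ = r := by
  rw [norm_mul, Complex.norm_exp_ofReal_mul_I, mul_one, Complex.norm_of_nonneg hr]

theorem mul_exp_mem_unitDisk {r : ℝ} (hr : 0 ≤ r) (hr1 : r < 1) (θ : ℝ) :
    (r : ℂ) * Complex.exp (θ * Complex.I) ∈ unitDisk := by
  rw [unitDisk, mem_ball_zero_iff, norm_mul_exp hr]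
  exact hr1

/-- The hypergeometric factors depend only on `|z|`, so on a circle they are constants and the
expansion is a Fourier series in `θ`. -/
theorem HasExpansion.hasSum {α β : ℝ} {u : ℂ → ℂ} {c : ℤ → ℂ} (h : HasExpansion α β u c)
    {r : ℝ} (hr : 0 ≤ r) (hr1 : r < 1) (θ : ℝ) :
    HasSum (fun n : ℤ => circleCoeff α β c r n * Complex.exp (n * θ * Complex.I))
      (u (r * Complex.exp (θ * Complex.I))) := by
  obtain ⟨h1, h2, h3⟩ := h.2 _ (mul_exp_mem_unitDisk hr hr1 θ)
  rw [h3]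
  apply HasSum.of_nat_of_neg_add_one
  · convert h1.hasSum using 2 with k
    rw [circleCoeff_natCast, posTerm, posTerm, norm_mul_exp hr, Complex.norm_of_nonneg hr, mul_pow,
      ← Complex.exp_nat_mul]
    push_cast
    ring_nf
  · convert h2.hasSum using 2 with k
    rw [circleCoeff_neg_succ, negTerm, negTerm, norm_mul_exp hr, Complex.norm_of_nonneg hr, map_mul,
      mul_pow, ← Complex.exp_conj, ← Complex.exp_nat_mul]
    simp only [map_mul, Complex.conj_ofReal, Complex.conj_I]
    push_cast
    ring_nf

theorem HasExpansion.circleCoeff_eq_integral {α β : ℝ} {u : ℂ → ℂ} {c : ℤ → ℂ}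
    (h : HasExpansion α β u c) {r : ℝ} (hr : 0 ≤ r) (hr1 : r < 1) (k : ℤ) :
    ∫ θ in -Real.pi..Real.pi, u (r * Complex.exp (θ * Complex.I)) *
      Complex.exp (-k * θ * Complex.I) = 2 * Real.pi * circleCoeff α β c r k :=
  integral_mul_exp_of_hasSum (fun θ => h.hasSum hr hr1 θ) k

theorem HasExpansion.circleCoeff_unique {α β : ℝ} {u : ℂ → ℂ} {c c' : ℤ → ℂ}
    (h : HasExpansion α β u c) (h' : HasExpansion α β u c') {r : ℝ} (hr : 0 ≤ r) (hr1 : r < 1)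
    (k : ℤ) : circleCoeff α β c r k = circleCoeff α β c' r k := by
  have hpi : (2 * Real.pi : ℂ) ≠ 0 := by exact_mod_cast Real.two_pi_pos.ne'
  exact mul_left_cancel₀ hpi
    ((h.circleCoeff_eq_integral hr hr1 k).symm.trans (h'.circleCoeff_eq_integral hr hr1 k))

theorem tendsto_sq_nhdsLT_one : Tendsto (fun r : ℝ => r ^ 2) (𝓝[<] 1) (𝓝[<] 1) := by
  apply tendsto_nhdsWithin_of_tendsto_nhds_of_eventually_within
  · have : Tendsto (fun r : ℝ => r ^ 2) (𝓝 1) (𝓝 (1 ^ 2)) := (continuous_pow 2).tendsto 1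
    rw [one_pow] at this
    exact this.mono_left nhdsWithin_le_nhds
  · filter_upwards [Ioo_mem_nhdsLT (zero_lt_one (α := ℝ))] with r hr
    exact pow_lt_one₀ hr.1.le hr.2 two_ne_zero

theorem tendsto_hypergeometric_mul_pow {α β : ℝ} (hαβ : -1 < α + β) (k : ℕ) :
    Tendsto (fun r : ℝ => ordinaryHypergeometric (-α) ((k : ℝ) - β) ((k : ℝ) + 1) (r ^ 2) * r ^ k)
      (𝓝[<] 1) (𝓝 (hypergeometricSum (-α) (k - β) (k + 1))) := by
  have h1 := (ordinaryHypergeometric_tendsto (a := -α) (b := k - β) (c := k + 1) (by positivity)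
    (by linarith)).comp tendsto_sq_nhdsLT_one
  have h2 : Tendsto (fun r : ℝ => r ^ k) (𝓝[<] 1) (𝓝 (1 ^ k)) :=
    ((continuous_pow k).tendsto 1).mono_left nhdsWithin_le_nhds
  simpa using h1.mul h2

theorem posTerm_ofReal (α β : ℝ) (c : ℤ → ℂ) {r : ℝ} (hr : 0 ≤ r) (k : ℕ) :
    posTerm α β c r k = c k *
      ((ordinaryHypergeometric (-α) ((k : ℝ) - β) ((k : ℝ) + 1) (r ^ 2) * r ^ k : ℝ) : ℂ) := by
  rw [posTerm, Complex.norm_of_nonneg hr]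
  push_cast
  ring

theorem negTerm_ofReal (α β : ℝ) (c : ℤ → ℂ) {r : ℝ} (hr : 0 ≤ r) (k : ℕ) :
    negTerm α β c r k = c (-(k : ℤ)) *
      ((ordinaryHypergeometric (-β) ((k : ℝ) - α) ((k : ℝ) + 1) (r ^ 2) * r ^ k : ℝ) : ℂ) := by
  rw [negTerm, Complex.norm_of_nonneg hr, Complex.conj_ofReal]
  push_cast
  ring

theorem tendsto_posTerm {α β : ℝ} (hαβ : -1 < α + β) (c : ℤ → ℂ) (k : ℕ) :
    Tendsto (fun r : ℝ => posTerm α β c r k) (𝓝[<] 1)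
      (𝓝 (c k * (hypergeometricSum (-α) (k - β) (k + 1) : ℝ))) := by
  refine (((Complex.continuous_ofReal.tendsto _).comp
    (tendsto_hypergeometric_mul_pow hαβ k)).const_mul (c k)).congr' ?_
  filter_upwards [Ioo_mem_nhdsLT (zero_lt_one (α := ℝ))] with r hr
  rw [posTerm_ofReal α β c hr.1.le, Function.comp]

theorem tendsto_negTerm {α β : ℝ} (hαβ : -1 < α + β) (c : ℤ → ℂ) (k : ℕ) :
    Tendsto (fun r : ℝ => negTerm α β c r k) (𝓝[<] 1)
      (𝓝 (c (-(k : ℤ)) * (hypergeometricSum (-β) (k - α) (k + 1) : ℝ))) := by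
  refine (((Complex.continuous_ofReal.tendsto _).comp
    (tendsto_hypergeometric_mul_pow (α := β) (β := α) (by linarith) k)).const_mul
      (c (-(k : ℤ)))).congr' ?_
  filter_upwards [Ioo_mem_nhdsLT (zero_lt_one (α := ℝ))] with r hr
  rw [negTerm_ofReal α β c hr.1.le, Function.comp]

theorem hypergeometricSum_shift_ne_zero {α β : ℝ} (hα : ∀ n : ℕ, α ≠ -((n : ℝ) + 1))
    (hβ : ∀ n : ℕ, β ≠ -((n : ℝ) + 1)) (hαβ : -1 < α + β) (k : ℕ) :
    hypergeometricSum (-α) (k - β) (k + 1) ≠ 0 := by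
  rw [hypergeometricSum_eq_Gamma hα hαβ k]
  have h1 : Real.Gamma (1 + α) ≠ 0 := Real.Gamma_ne_zero fun n h => hα n (by linarith)
  have h2 : Real.Gamma (k + 1 + α) ≠ 0 := Real.Gamma_ne_zero fun n h => hα (n + k) (by
    push_cast; linarith)
  exact mul_ne_zero (mul_ne_zero (by exact_mod_cast k.factorial_ne_zero)
    (hypergeometricSum_ne_zero hα hβ hαβ)) (div_ne_zero h1 h2)

/-- The coefficients of the expansion are determined by the function. -/
theorem HasExpansion.unique {α β : ℝ} (hα : ∀ n : ℕ, α ≠ -((n : ℝ) + 1))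
    (hβ : ∀ n : ℕ, β ≠ -((n : ℝ) + 1)) (hαβ : -1 < α + β) {u : ℂ → ℂ} {c c' : ℤ → ℂ}
    (h : HasExpansion α β u c) (h' : HasExpansion α β u c') : c = c' := by
  have hev : ∀ n : ℤ, ∀ᶠ r : ℝ in 𝓝[<] 1, circleCoeff α β c r n = circleCoeff α β c' r n :=
    fun n => by
      filter_upwards [Ioo_mem_nhdsLT (zero_lt_one (α := ℝ))] with r hr
      exact h.circleCoeff_unique h' hr.1.le hr.2 n
  funext n
  rcases lt_or_ge n 0 with hn | hn
  · obtain ⟨k, rfl⟩ : ∃ k : ℕ, n = -((k : ℤ) + 1) := ⟨(-n - 1).toNat, by omega⟩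
    have h1 := tendsto_nhds_unique ((tendsto_negTerm hαβ c (k + 1)).congr' (by
      filter_upwards [hev (-((k : ℤ) + 1))] with r hr
      rwa [circleCoeff_neg_succ, circleCoeff_neg_succ] at hr)) (tendsto_negTerm hαβ c' (k + 1))
    have h2 := hypergeometricSum_shift_ne_zero hβ hα (by linarith) (k + 1)
    have := mul_right_cancel₀ (by exact_mod_cast h2) h1
    exact_mod_cast this
  · lift n to ℕ using hn
    have h1 := tendsto_nhds_unique ((tendsto_posTerm hαβ c n).congr' (by
      filter_upwards [hev n] with r hr
      rwa [circleCoeff_natCast, circleCoeff_natCast] at hr)) (tendsto_posTerm hαβ c' n)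
    exact mul_right_cancel₀ (by exact_mod_cast hypergeometricSum_shift_ne_zero hα hβ hαβ n) h1

end AlphaBetaHarmonic

/-! ### Sign of the imaginary part and the sine-coefficient bound -/

theorem abs_sin_nat_mul_le (k : ℕ) (θ : ℝ) : |Real.sin (k * θ)| ≤ k * |Real.sin θ| := by
  induction k with
  | zero => simp
  | succ k ih =>
    push_cast
    rw [add_mul, one_mul, Real.sin_add]
    calc |Real.sin (k * θ) * Real.cos θ + Real.cos (k * θ) * Real.sin θ|
        ≤ |Real.sin (k * θ)| * |Real.cos θ| + |Real.cos (k * θ)| * |Real.sin θ| := by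
          rw [← abs_mul, ← abs_mul]; exact abs_add_le _ _
      _ ≤ |Real.sin (k * θ)| * 1 + 1 * |Real.sin θ| := by
          gcongr
          · exact Real.abs_cos_le_one θ
          · exact Real.abs_cos_le_one _
      _ ≤ (k + 1) * |Real.sin θ| := by linarith

namespace AlphaBetaHarmonic

theorem HasExpansion.map_conj {α β : ℝ} {u : ℂ → ℂ} {c : ℤ → ℝ}
    (h : HasExpansion α β u fun k => (c k : ℂ)) {z : ℂ} (hz : z ∈ unitDisk) :
    u (starRingEnd ℂ z) = starRingEnd ℂ (u z) := by
  have hz' : starRingEnd ℂ z ∈ unitDisk := by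
    rw [unitDisk, mem_ball_zero_iff] at hz ⊢
    rwa [Complex.norm_conj]
  rw [(h.2 _ hz).2.2, (h.2 _ hz').2.2, map_add, Complex.conj_tsum, Complex.conj_tsum]
  congr 1 <;> refine tsum_congr fun k => ?_
  · simp [posTerm]
  · simp [negTerm]

/-- An injective continuous function on the disk commuting with conjugation maps each half disk
into a half plane. -/
theorem im_mul_im_sign {u : ℂ → ℂ} (hcont : ContinuousOn u unitDisk)
    (hinj : Set.InjOn u unitDisk)
    (hconj : ∀ z ∈ unitDisk, u (starRingEnd ℂ z) = starRingEnd ℂ (u z)) :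
    (∀ z ∈ unitDisk, 0 ≤ (u z).im * z.im) ∨ (∀ z ∈ unitDisk, (u z).im * z.im ≤ 0) := by
  set S : Set ℂ := unitDisk ∩ {z | 0 < z.im} with hS
  have hconj_mem : ∀ z ∈ unitDisk, starRingEnd ℂ z ∈ unitDisk := fun z hz => by
    rw [unitDisk, mem_ball_zero_iff] at hz ⊢
    rwa [Complex.norm_conj]
  have hpre : IsPreconnected S :=
    ((convex_ball (0 : ℂ) 1).inter (convex_halfSpace_im_gt 0)).isPreconnected
  -- If `u z` is real then `u` agrees at `z` and `conj z`, so injectivity makes `z` real.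
  have hne : ∀ z ∈ S, (u z).im ≠ 0 := fun z hz h0 => by
    have h1 : starRingEnd ℂ (u z) = u z := Complex.conj_eq_iff_im.2 h0
    have h2 := hinj (hconj_mem z hz.1) hz.1 ((hconj z hz.1).trans h1)
    exact hz.2.ne' (Complex.conj_eq_iff_im.1 h2)
  have hc : ContinuousOn (fun z => (u z).im) S :=
    Complex.continuous_im.comp_continuousOn (hcont.mono Set.inter_subset_left)
  have hsign : (∀ z ∈ S, 0 ≤ (u z).im) ∨ (∀ z ∈ S, (u z).im ≤ 0) := by
    by_contra! hcon
    obtain ⟨⟨z, hz, hz0⟩, w, hw, hw0⟩ := hcon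
    obtain ⟨x, hx, hx0⟩ := hpre.intermediate_value hz hw hc ⟨hz0.le, hw0.le⟩
    exact hne x hx hx0
  -- Conjugation flips the sign of both factors, which carries the sign to the lower half disk.
  have hlower : ∀ z ∈ unitDisk, (u z).im * z.im =
      (u (starRingEnd ℂ z)).im * (starRingEnd ℂ z).im := fun z hz => by
    rw [hconj z hz, Complex.conj_im, Complex.conj_im, neg_mul_neg]
  refine hsign.imp (fun h z hz => ?_) (fun h z hz => ?_) <;>
    rcases lt_trichotomy z.im 0 with hi | hi | hi
  · rw [hlower z hz]
    have hi' : 0 < (starRingEnd ℂ z).im := by simpa using hi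
    exact mul_nonneg (h _ ⟨hconj_mem z hz, hi'⟩) hi'.le
  · simp [hi]
  · exact mul_nonneg (h z ⟨hz, hi⟩) hi.le
  · rw [hlower z hz]
    have hi' : 0 < (starRingEnd ℂ z).im := by simpa using hi
    exact mul_nonpos_of_nonpos_of_nonneg (h _ ⟨hconj_mem z hz, hi'⟩) hi'.le
  · simp [hi]
  · exact mul_nonpos_of_nonpos_of_nonneg (h z ⟨hz, hi⟩) hi.le

/-- This is the real part of the difference of two coefficient integrals, since `Re (w (e^{-ikθ} -
e^{ikθ})) = 2 Im w sin kθ`. -/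
theorem integral_im_mul_sin {α β : ℝ} {u : ℂ → ℂ} {c : ℤ → ℂ} (h : HasExpansion α β u c)
    (hcont : ContinuousOn u unitDisk) {r : ℝ} (hr : 0 ≤ r) (hr1 : r < 1) (k : ℤ) :
    ∫ θ in -Real.pi..Real.pi, (u (r * Complex.exp (θ * Complex.I))).im * Real.sin (k * θ) =
      Real.pi * (circleCoeff α β c r k - circleCoeff α β c r (-k)).re := by
  have hg : Continuous fun θ : ℝ => u (r * Complex.exp (θ * Complex.I)) :=
    hcont.comp_continuous (by fun_prop) (mul_exp_mem_unitDisk hr hr1)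
  have h1 := h.circleCoeff_eq_integral hr hr1 k
  have h2 := h.circleCoeff_eq_integral hr hr1 (-k)
  have h3 := intervalIntegral.integral_sub (μ := MeasureTheory.volume) (a := -Real.pi)
    (b := Real.pi)
    (f := fun θ : ℝ => u (r * Complex.exp (θ * Complex.I)) * Complex.exp (-k * θ * Complex.I))
    (g := fun θ : ℝ => u (r * Complex.exp (θ * Complex.I)) *
      Complex.exp (-(-k : ℤ) * θ * Complex.I))
    ((hg.mul (by fun_prop)).intervalIntegrable _ _)
    ((hg.mul (by fun_prop)).intervalIntegrable _ _)
  rw [h1, h2, ← mul_sub] at h3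
  have h4 := intervalIntegral.intervalIntegral_re (μ := MeasureTheory.volume) (a := -Real.pi)
    (b := Real.pi) (f := fun θ : ℝ =>
      u (r * Complex.exp (θ * Complex.I)) * Complex.exp (-k * θ * Complex.I) -
      u (r * Complex.exp (θ * Complex.I)) * Complex.exp (-(-k : ℤ) * θ * Complex.I))
    (((hg.mul (by fun_prop)).sub (hg.mul (by fun_prop))).intervalIntegrable _ _)
  rw [h3] at h4
  have h5 : ∀ θ : ℝ, RCLike.re (u (r * Complex.exp (θ * Complex.I)) *
        Complex.exp (-k * θ * Complex.I) -
      u (r * Complex.exp (θ * Complex.I)) * Complex.exp (-(-k : ℤ) * θ * Complex.I)) =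
      2 * ((u (r * Complex.exp (θ * Complex.I))).im * Real.sin (k * θ)) := fun θ => by
    have e1 : Complex.exp (-k * θ * Complex.I) = Complex.exp (((-(k * θ) : ℝ) : ℂ) * Complex.I) := by
      push_cast; ring_nf
    have e2 : Complex.exp (-(-k : ℤ) * θ * Complex.I) =
        Complex.exp (((k * θ : ℝ) : ℂ) * Complex.I) := by
      push_cast; ring_nf
    rw [e1, e2, ← mul_sub]
    change Complex.re _ = _
    rw [Complex.mul_re, Complex.sub_re, Complex.sub_im, Complex.exp_ofReal_mul_I_re,
      Complex.exp_ofReal_mul_I_re, Complex.exp_ofReal_mul_I_im, Complex.exp_ofReal_mul_I_im,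
      Real.sin_neg, Real.cos_neg]
    ring
  simp only [h5, intervalIntegral.integral_const_mul] at h4
  have h6 : RCLike.re (2 * (Real.pi : ℂ) * (circleCoeff α β c r k - circleCoeff α β c r (-k))) =
      2 * (Real.pi * (circleCoeff α β c r k - circleCoeff α β c r (-k)).re) := by
    have e : 2 * (Real.pi : ℂ) * (circleCoeff α β c r k - circleCoeff α β c r (-k)) =
      ((2 * Real.pi : ℝ) : ℂ) * (circleCoeff α β c r k - circleCoeff α β c r (-k)) := by push_cast; ring
    rw [e]
    change Complex.re _ = _
    rw [Complex.re_ofReal_mul, mul_assoc]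
  rw [h6] at h4
  linarith

/-- Constant sign makes `∫ |v sin θ|` equal to `|∫ v sin θ|`, so the pointwise bound on `sin kθ`
integrates without loss. -/
theorem abs_integral_mul_sin_le {v : ℝ → ℝ} (hv : Continuous v)
    (hsign : (∀ θ, 0 ≤ v θ * Real.sin θ) ∨ (∀ θ, v θ * Real.sin θ ≤ 0)) (k : ℕ) :
    |∫ θ in -Real.pi..Real.pi, v θ * Real.sin (k * θ)| ≤
      k * |∫ θ in -Real.pi..Real.pi, v θ * Real.sin θ| := by
  have hpi : -Real.pi ≤ Real.pi := by linarith [Real.pi_pos]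
  have habs : ∫ θ in -Real.pi..Real.pi, |v θ * Real.sin θ| =
      |∫ θ in -Real.pi..Real.pi, v θ * Real.sin θ| := by
    rcases hsign with h | h
    · simp only [fun θ => abs_of_nonneg (h θ)]
      exact (abs_of_nonneg (intervalIntegral.integral_nonneg hpi fun θ _ => h θ)).symm
    · simp only [fun θ => abs_of_nonpos (h θ), intervalIntegral.integral_neg]
      have h0 : 0 ≤ ∫ θ in -Real.pi..Real.pi, -(v θ * Real.sin θ) :=
        intervalIntegral.integral_nonneg hpi fun θ _ => neg_nonneg.2 (h θ)
      rw [intervalIntegral.integral_neg] at h0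
      exact (abs_of_nonpos (by linarith)).symm
  calc |∫ θ in -Real.pi..Real.pi, v θ * Real.sin (k * θ)|
      ≤ ∫ θ in -Real.pi..Real.pi, |v θ * Real.sin (k * θ)| :=
        intervalIntegral.abs_integral_le_integral_abs hpi
    _ ≤ ∫ θ in -Real.pi..Real.pi, k * |v θ * Real.sin θ| := by
        refine intervalIntegral.integral_mono_on hpi
          (Continuous.intervalIntegrable (by fun_prop) _ _)
          (Continuous.intervalIntegrable (by fun_prop) _ _) fun θ _ => ?_
        rw [abs_mul, abs_mul, mul_left_comm]
        exact mul_le_mul_of_nonneg_left (abs_sin_nat_mul_le k θ) (abs_nonneg _)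
    _ = k * |∫ θ in -Real.pi..Real.pi, v θ * Real.sin θ| := by
        rw [intervalIntegral.integral_const_mul, habs]

theorem circleCoeff_neg_natCast (α β : ℝ) (c : ℤ → ℂ) (r : ℝ) {k : ℕ} (hk : 1 ≤ k) :
    circleCoeff α β c r (-(k : ℤ)) = negTerm α β c r k := by
  obtain ⟨m, rfl⟩ := Nat.exists_eq_add_of_le' hk
  simpa using circleCoeff_neg_succ α β c r m

/-- The coefficient bound on each circle. -/
theorem norm_posTerm_sub_negTerm_le {α β : ℝ} {u : ℂ → ℂ} {c : ℤ → ℝ}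
    (h : HasExpansion α β u fun k => (c k : ℂ)) (hcont : ContinuousOn u unitDisk)
    (hinj : Set.InjOn u unitDisk) {r : ℝ} (hr : 0 < r) (hr1 : r < 1) {k : ℕ} (hk : 1 ≤ k) :
    ‖posTerm α β (fun k => (c k : ℂ)) r k - negTerm α β (fun k => (c k : ℂ)) r k‖ ≤
      k * ‖posTerm α β (fun k => (c k : ℂ)) r 1 - negTerm α β (fun k => (c k : ℂ)) r 1‖ := by
  have hnorm : ∀ {m : ℕ}, 1 ≤ m →
      Real.pi * ‖posTerm α β (fun k => (c k : ℂ)) r m - negTerm α β (fun k => (c k : ℂ)) r m‖ =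
      |∫ θ in -Real.pi..Real.pi, (u (r * Complex.exp (θ * Complex.I))).im * Real.sin (m * θ)| := by
    intro m hm
    have := integral_im_mul_sin h hcont hr.le hr1 m
    rw [circleCoeff_natCast, circleCoeff_neg_natCast α β _ r hm] at this
    simp only [Int.cast_natCast] at this
    rw [this, abs_mul, abs_of_pos Real.pi_pos]
    congr 1
    rw [posTerm_ofReal α β _ hr.le, negTerm_ofReal α β _ hr.le, ← Complex.ofReal_mul,
      ← Complex.ofReal_mul, ← Complex.ofReal_sub, Complex.ofReal_re, Complex.norm_real,
      Real.norm_eq_abs]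
  have hg : Continuous fun θ : ℝ => (u (r * Complex.exp (θ * Complex.I))).im :=
    Complex.continuous_im.comp
      (hcont.comp_continuous (by fun_prop) (mul_exp_mem_unitDisk hr.le hr1))
  have him : ∀ θ : ℝ, ((r : ℂ) * Complex.exp (θ * Complex.I)).im = r * Real.sin θ := fun θ => by
    rw [Complex.im_ofReal_mul, Complex.exp_ofReal_mul_I_im]
  have hmem := mul_exp_mem_unitDisk hr.le hr1
  have hsign := (im_mul_im_sign hcont hinj fun z hz => h.map_conj hz).imp
    (fun H (θ : ℝ) => show 0 ≤ (u (r * Complex.exp (θ * Complex.I))).im * Real.sin θ by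
      have := H _ (hmem θ)
      rw [him, mul_left_comm] at this
      exact nonneg_of_mul_nonneg_right this hr)
    (fun H (θ : ℝ) => show (u (r * Complex.exp (θ * Complex.I))).im * Real.sin θ ≤ 0 by
      have := H _ (hmem θ)
      rw [him, mul_left_comm] at this
      exact nonpos_of_mul_nonpos_right this hr)
  have key := abs_integral_mul_sin_le hg hsign k
  have h1 := hnorm le_rfl
  simp only [Nat.cast_one, one_mul] at h1
  rw [← hnorm hk, ← h1, mul_left_comm] at key
  exact le_of_mul_le_mul_left key Real.pi_pos

/-- The coefficient bound with the hypergeometric values at the boundary. -/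
theorem norm_sub_le_of_hasExpansion {α β : ℝ} (hαβ : -1 < α + β) {u : ℂ → ℂ} {c : ℤ → ℝ}
    (h : HasExpansion α β u fun k => (c k : ℂ)) (hcont : ContinuousOn u unitDisk)
    (hinj : Set.InjOn u unitDisk) {k : ℕ} (hk : 1 ≤ k) :
    ‖(c k : ℂ) * (hypergeometricSum (-α) (k - β) (k + 1) : ℝ) -
        c (-(k : ℤ)) * (hypergeometricSum (-β) (k - α) (k + 1) : ℝ)‖ ≤
      k * ‖(c 1 : ℂ) * (hypergeometricSum (-α) (1 - β) (1 + 1) : ℝ) -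
        c (-1) * (hypergeometricSum (-β) (1 - α) (1 + 1) : ℝ)‖ := by
  have hlim := fun m : ℕ => ((tendsto_posTerm hαβ (fun k => (c k : ℂ)) m).sub
    (tendsto_negTerm hαβ (fun k => (c k : ℂ)) m)).norm
  have h1 := hlim 1
  simp only [Nat.cast_one] at h1
  refine le_of_tendsto_of_tendsto (hlim k) (h1.const_mul (k : ℝ)) ?_
  filter_upwards [Ioo_mem_nhdsLT (zero_lt_one (α := ℝ))] with r hr
  exact norm_posTerm_sub_negTerm_le h hcont hinj hr.1 hr.2 hk

end AlphaBetaHarmonic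

/-! ### Conclusion -/

theorem mainTheorem6 (α β : ℝ)
    (hα : ∀ n : ℕ, α ≠ -((n : ℝ) + 1)) (hβ : ∀ n : ℕ, β ≠ -((n : ℝ) + 1))
    (hαβ : -1 < α + β)
    (u : ℂ → ℂ) (hu : u ∈ AlphaBetaHarmonic.classTS α β)
    (c : ℤ → ℂ) (hc : AlphaBetaHarmonic.HasExpansion α β u c)
    (k : ℕ) (hk : 2 ≤ k) :
    ‖(Real.Gamma (1 + α) : ℂ) * c k / (Real.Gamma ((k : ℝ) + 1 + α) : ℂ)
        - (Real.Gamma (1 + β) : ℂ) * c (-(k : ℤ)) / (Real.Gamma ((k : ℝ) + 1 + β) : ℂ)‖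
      ≤ 1 / Real.Gamma (k : ℝ) *
        ‖1 / (1 + (α : ℂ)) - c (-1) / (1 + (β : ℂ))‖ := by
  obtain ⟨⟨hharm, hinj, -, c₁, hc₁, -, hone⟩, c₂, hc₂⟩ := hu
  -- The given, the normalized and the real coefficient sequences are a priori different; uniqueness
  -- identifies them.
  obtain rfl := hc.unique hα hβ hαβ hc₁
  obtain rfl := hc.unique hα hβ hαβ hc₂
  have hone' : c₂ 1 = 1 := Complex.ofReal_eq_one.1 hone
  have key := AlphaBetaHarmonic.norm_sub_le_of_hasExpansion hαβ hc₂ hharm.1.continuousOn hinj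
    (show 1 ≤ k by omega)
  have hβα : -1 < β + α := by linarith
  set G := hypergeometricSum (-α) (-β) 1 with hG
  have hG0 : G ≠ 0 := hypergeometricSum_ne_zero hα hβ hαβ
  have hA := hypergeometricSum_eq_Gamma hα hαβ
  have hB := hypergeometricSum_eq_Gamma hβ hβα
  -- By symmetry both families of boundary values share the factor `G`.
  rw [hypergeometricSum_comm (-β) (-α), ← hG] at hB
  rw [← hG] at hA
  have hratio : ∀ {γ : ℝ}, (∀ n : ℕ, γ ≠ -((n : ℝ) + 1)) →
      Real.Gamma (1 + γ) / Real.Gamma ((1 : ℕ) + 1 + γ) = 1 / (1 + γ) := fun {γ} hγ => by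
    have h0 : 1 + γ ≠ 0 := fun h => hγ 0 (by push_cast; linarith)
    have hΓ : Real.Gamma (1 + γ) ≠ 0 := Real.Gamma_ne_zero fun n h => hγ n (by linarith)
    rw [Nat.cast_one, add_assoc, add_comm 1 (1 + γ), Real.Gamma_add_one h0]
    field_simp
  have hA1 := hA 1
  have hB1 := hB 1
  rw [hratio hα, Nat.factorial_one] at hA1
  rw [hratio hβ, Nat.factorial_one] at hB1
  simp only [Nat.cast_one, one_mul] at hA1 hB1
  rw [hA k, hB k, hA1, hB1, hone'] at key
  have e1 : ((c₂ k : ℂ) * ((k.factorial * G * (Real.Gamma (1 + α) / Real.Gamma (k + 1 + α)) : ℝ) : ℂ) -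
      c₂ (-(k : ℤ)) * ((k.factorial * G * (Real.Gamma (1 + β) / Real.Gamma (k + 1 + β)) : ℝ) : ℂ)) =
      ((k.factorial * G : ℝ) : ℂ) *
        ((Real.Gamma (1 + α) : ℂ) * c₂ k / (Real.Gamma ((k : ℝ) + 1 + α) : ℂ)
        - (Real.Gamma (1 + β) : ℂ) * c₂ (-(k : ℤ)) / (Real.Gamma ((k : ℝ) + 1 + β) : ℂ)) := by
    push_cast
    ring
  have e2 : (((1 : ℝ) : ℂ) * ((G * (1 / (1 + α)) : ℝ) : ℂ) -
      c₂ (-1) * ((G * (1 / (1 + β)) : ℝ) : ℂ)) =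
      (G : ℂ) * (1 / (1 + (α : ℂ)) - c₂ (-1) / (1 + (β : ℂ))) := by
    push_cast
    ring
  rw [e1, e2, norm_mul, norm_mul, Complex.norm_real, Complex.norm_real, norm_mul,
    Real.norm_natCast] at key
  have hGpos : 0 < ‖G‖ := norm_pos_iff.2 hG0
  obtain ⟨m, rfl⟩ := Nat.exists_eq_add_of_le' (show 1 ≤ k by omega)
  have hm : 0 < (m.factorial : ℝ) := by positivity
  have hΓ : Real.Gamma ((m + 1 : ℕ) : ℝ) = m.factorial := by
    rw [Nat.cast_succ, Real.Gamma_nat_eq_factorial]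
  rw [hΓ, one_div, ← div_eq_inv_mul, le_div_iff₀ hm]
  -- With `k = m + 1`, `k! = k * m!` and `m! = Γ(k)`, so `k ‖G‖` is the factor common to both sides.
  refine le_of_mul_le_mul_left ?_ (show (0 : ℝ) < ((m + 1 : ℕ) : ℝ) * ‖G‖ by positivity)
  rw [Nat.factorial_succ, Nat.cast_mul] at key
  calc _ = _ := by ring
    _ ≤ _ := key
    _ = _ := by ring
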